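/- **Theorem (Asymptotic radius of Bayesian credible regions).** Let $\alpha\in(0,\tfrac12)$. For $S\ge 2$ put $$\kappa_S=\frac{\sqrt{\chi^2_{S-1,1-\alpha}}}{\Phi^{-1}(1-\alpha)},$$ where $\chi^2_{S-1,1-\alpha}$ and $\Phi^{-1}(1-\alpha)$ are the $(1-\alpha)$-quantiles of the chi-squared distribution with $S-1$ degrees of freedom and of the standard normal distribution. *Setting.* Let there be $S\ge 2$ states and $A$ actions, let $\Delta^S\subset\mathbb R^S$ be the probability simplex, and let $p^*_{s,a}\in\Delta^S$ be the true transition probabilities. For each $N\in\mathbb N$ let $\tilde P^N=(\tilde p^N_{s,a})_{s,a}$ be random transition probabilities with values in $\Delta^S$, distributed according to the posterior after $N$ observations. Assume that the posterior is asymptotically normal: for all $s,a$, $$\sqrt N(\tilde p^N_{s,a}-p^*_{s,a})\rightsquigarrow\mathcal N(0,\Sigma_{s,a})\qquad(N\to\infty)$$ in distribution, where $\Sigma_{s,a}$ (the inverse Fisher information) is a positive semidefinite $S\times S$ matrix of rank $S-1$. *VaR ambiguity sets.* With $\mathrm{VaR}_\alpha[X]=\sup\{t:\Pr[X\ge t]\ge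 1-\alpha\}$ let $$\mathcal P^{\mathrm{VaR},N}_{s,a}=\bigcap_{v\in\mathbb R^S}\bigl\{p\in\Delta^S : p^\top v\ge \mathrm{VaR}_\alpha[(\tilde p^N_{s,a})^\top v]\bigr\}.$$ *Credible regions.* A Bayesian credible region is a set $\mathcal P^{\mathrm{BCR},N}_{s,a}\subseteq\Delta^S$ with $\Pr[\tilde p^N_{s,a}\in\mathcal P^{\mathrm{BCR},N}_{s,a}]\ge 1-\alpha$. Limits of sequences of sets are Painlevé–Kuratowski limits; $\operatorname{Ls}$ denotes the outer limit, which is the limit whenever the latter exists. *Conclusion.* There are constants $c>0$ and $c'$ that depend only on $\alpha$ such that the following holds. 1. $c\sqrt S\le\kappa_S\le c'\sqrt S$ for all $S\ge 2$. 2. In every such setting and for all $s,a$, the limit $V_\xi=\lim_{N\to\infty}\sqrt N\,\xi\,(\mathcal P^{\mathrm{VaR},N}_{s,a}-p^*_{s,a})$ exists for every real $\xi$, and for every sequence of Bayesian credible regions $\mathcal P^{\mathrm{BCR},N}_{s,a}$ and every real $\xi$ with $|\xi|<\kappa_S$, $$\operatorname{Ls}_{N\to\infty}\sqrt N(\mathcal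 P^{\mathrm{BCR},N}_{s,a}-p^*_{s,a})\not\subseteq V_\xi;$$ in particular $\lim_{N\to\infty}\sqrt N(\mathcal P^{\mathrm{BCR},N}_{s,a}-p^*_{s,a})\not\subseteq V_\xi$ whenever this limit exists. 3. In the situation of 2 there are a direction $u\neq 0$ and $t>0$ with $tu\in\operatorname{Ls}_{N\to\infty}\sqrt N(\mathcal P^{\mathrm{BCR},N}_{s,a}-p^*_{s,a})$ such that $c\sqrt S\,r<t$ for every $r\ge 0$ with $ru\in V_1$. That is, in the direction $u$ the scaled limit of the credible regions reaches more than $c\sqrt S$ times as far as that of the VaR ambiguity sets. -/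

import Mathlib

open MeasureTheory ProbabilityTheory Filter Topology
open scoped Pointwise

noncomputable section

namespace CredibleRadius

/-- The space `ℝ^S` in which the transition probability vectors live. -/
abbrev Vec (S : ℕ) : Type := EuclideanSpace ℝ (Fin S)

/-- A family `(p_{s,a})` of vectors of `ℝ^S`, one for each state `s` and action `a`. -/
abbrev Model (S A : ℕ) : Type := Fin S → Fin A → Vec S

/-- The probability simplex `Δ^S`. -/
def simplex (S : ℕ) : Set (Vec S) :=
  {p | (∀ i, 0 ≤ p i) ∧ ∑ i, p i = 1}

/-- The (lower) quantile function of a probability measure on `ℝ`. -/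
def quantile (μ : Measure ℝ) (q : ℝ) : ℝ :=
  sInf {x : ℝ | q ≤ cdf μ x}

/-- The chi-squared distribution with `k` degrees of freedom: the law of the sum of the squares of
`k` independent standard normal variables. -/
def chiSquared (k : ℕ) : Measure ℝ :=
  (Measure.pi (fun _ : Fin k => gaussianReal 0 1)).map (fun x => ∑ i, x i ^ 2)

/-- `√(χ²_{S-1,1-α}) / Φ⁻¹(1-α)`. -/
def radiusRatio (S : ℕ) (α : ℝ) : ℝ :=
  √(quantile (chiSquared (S - 1)) (1 - α)) / quantile (gaussianReal 0 1) (1 - α)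

/-- `VaR_α[X] = sup {t : Pr[X ≥ t] ≥ 1 - α}`. -/
def valueAtRisk {Ω : Type*} [MeasurableSpace Ω] (μ : Measure Ω) (α : ℝ) (X : Ω → ℝ) : ℝ :=
  sSup {t : ℝ | 1 - α ≤ μ.real {ω | t ≤ X ω}}

/-- The VaR ambiguity set for the value function `v`: the `p ∈ Δ^S` with
`pᵀ v ≥ VaR_α[p̃_{s,a}ᵀ v]`, where `p̃` has law `μ`. -/
def varSetAt {S A : ℕ} (μ : Measure (Model S A)) (α : ℝ) (s : Fin S) (a : Fin A) (v : Vec S) :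
    Set (Vec S) :=
  {p | p ∈ simplex S ∧ valueAtRisk μ α (fun P => inner ℝ (P s a) v) ≤ inner ℝ p v}

/-- The VaR ambiguity set that does not depend on the value function: the intersection of the sets
`varSetAt` over all value functions `v`. -/
def varSet {S A : ℕ} (μ : Measure (Model S A)) (α : ℝ) (s : Fin S) (a : Fin A) : Set (Vec S) :=
  ⋂ v : Vec S, varSetAt μ α s a v

/-- `C ⊆ Δ^S` is a Bayesian credible region for `p̃_{s,a}` at confidence level `1 - α`. -/
def IsCredibleRegion {S A : ℕ} (μ : Measure (Model S A)) (α : ℝ) (s : Fin S) (a : Fin A)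
    (C : Set (Vec S)) : Prop :=
  C ⊆ simplex S ∧ 1 - α ≤ μ.real {P | P s a ∈ C}

/-- Asymptotic normality of the posterior: for all `s, a`, if `P` has law `post N`, then
`√N (P_{s,a} - p*_{s,a})` converges in distribution, as `N → ∞`, to the centered normal law with
covariance matrix `cov s a`. This matrix is degenerate (the entries of a transition vector
sum to one), but it has the largest possible rank `S - 1`. -/
def AsymptoticallyNormal {S A : ℕ} (post : ℕ → Measure (Model S A))
    [∀ N, IsProbabilityMeasure (post N)] (pstar : Model S A)
    (cov : Fin S → Fin A → Matrix (Fin S) (Fin S) ℝ) : Prop :=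
  ∀ s a, (cov s a).PosSemidef ∧ (cov s a).rank = S - 1 ∧
    TendstoInDistribution (fun (N : ℕ) (P : Model S A) => √(N : ℝ) • (P s a - pstar s a)) atTop id
      post (multivariateGaussian 0 (cov s a))

/-- Outer (upper) limit of a sequence of sets, in the sense of Painlevé and Kuratowski. -/
def outerLim {E : Type*} [TopologicalSpace E] (C : ℕ → Set E) : Set E :=
  {x | ∀ U ∈ 𝓝 x, ∃ᶠ N in atTop, (C N ∩ U).Nonempty}

/-- Inner (lower) limit of a sequence of sets, in the sense of Painlevé and Kuratowski. -/
def innerLim {E : Type*} [TopologicalSpace E] (C : ℕ → Set E) : Set E :=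
  {x | ∀ U ∈ 𝓝 x, ∀ᶠ N in atTop, (C N ∩ U).Nonempty}

/-- `C N` converges to the set `L` as `N → ∞`: inner and outer limit are both equal to `L`. -/
def SetTendsto {E : Type*} [TopologicalSpace E] (C : ℕ → Set E) (L : Set E) : Prop :=
  innerLim C = L ∧ outerLim C = L

/-- `√N ξ (C_N - x)`. -/
def scaled {S : ℕ} (ξ : ℝ) (C : ℕ → Set (Vec S)) (x : Vec S) (N : ℕ) : Set (Vec S) :=
  (fun p => (√(N : ℝ) * ξ) • (p - x)) '' C N

end CredibleRadius

end

/-!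
By Hahn-Banach, the half-spaces already force `p ∈ Δ^S`, so the VaR ambiguity set is the convex
floating body of `p̃_{s,a}`: the intersection of all closed half-spaces of posterior probability at
least `1 - α`. Floating bodies are equivariant under the maps `p ↦ √N (p - p*)`. Write
`Σ_{s,a} = T T†`, so that the limit law is the image under `T` of the standard normal law. The mass
that the latter gives to `{y | -r ‖w‖ ≤ ⟪y, w⟫}` is `Φ(r)`, so the limit of the VaR sets is the
ellipsoid `T (closedBall 0 z)` with `z = Φ⁻¹(1 - α)`. The posterior lives on an affine
hyperplane, whose direction is the range of `T` because `Σ_{s,a}` has rank `S - 1`; hence each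
half-space counts only through the projection of its normal vector to that range.

The outer limit of the credible regions keeps limit mass at least `1 - α`, by the portmanteau
theorem, while the ellipsoid `T (closedBall 0 r)` has mass `F(r ^ 2)` with `F` the `χ²_{S-1}`
distribution function. It contains the outer limit only if `√(χ²_{S-1,1-α}) ≤ r`.

The `χ²_k` quantile is linear in `k` up to constants: Markov's inequality bounds it above by
`k / α`, and Markov's inequality applied to the number of small summands bounds it below.
-/

noncomputable section

namespace CredibleRadius

open Metric
open scoped RealInnerProductSpace InnerProduct

section Quantile

variable {μ : Measure ℝ} {q x : ℝ}

lemma bddBelow_setOf_le_cdf (hq : 0 < q) : BddBelow {x | q ≤ cdf μ x} := by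
  obtain ⟨b, hb⟩ := ((tendsto_cdf_atBot μ).eventually_lt_const hq).exists
  exact ⟨b, fun y hy => le_of_not_gt fun h => (hy.trans (monotone_cdf μ h.le)).not_gt hb⟩

lemma nonempty_setOf_le_cdf (hq : q < 1) : {x | q ≤ cdf μ x}.Nonempty := by
  obtain ⟨b, hb⟩ := ((tendsto_cdf_atTop μ).eventually_const_lt hq).exists
  exact ⟨b, hb.le⟩

lemma quantile_le_iff (hq : q ∈ Set.Ioo (0 : ℝ) 1) : quantile μ q ≤ x ↔ q ≤ cdf μ x := by
  refine ⟨fun h => ?_, csInf_le (bddBelow_setOf_le_cdf hq.1)⟩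
  have hright : Tendsto (cdf μ) (𝓝[>] x) (𝓝 (cdf μ x)) :=
    ((cdf μ).right_continuous x).mono Set.Ioi_subset_Ici_self
  refine ge_of_tendsto hright ?_
  filter_upwards [self_mem_nhdsWithin] with y (hy : x < y)
  obtain ⟨w, hw, hwy⟩ := exists_lt_of_csInf_lt (nonempty_setOf_le_cdf hq.2) (h.trans_lt hy)
  exact le_trans hw (monotone_cdf μ hwy.le)

lemma lt_quantile_iff (hq : q ∈ Set.Ioo (0 : ℝ) 1) : x < quantile μ q ↔ cdf μ x < q := by
  simpa only [not_le] using (quantile_le_iff hq).not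

lemma quantile_le_integral_div [IsProbabilityMeasure μ] (hq : q ∈ Set.Ioo (0 : ℝ) 1)
    (hnonneg : ∀ᵐ x ∂μ, 0 ≤ x) (hint : Integrable id μ) :
    quantile μ q ≤ (∫ x, x ∂μ) / (1 - q) := by
  set m := ∫ x, x ∂μ
  have hq1 : 0 < 1 - q := sub_pos.2 hq.2
  refine le_of_forall_gt_imp_ge_of_dense fun x hx => (quantile_le_iff hq).2 ?_
  have hm : 0 ≤ m := integral_nonneg_of_ae hnonneg
  have hx0 : 0 < x := (div_nonneg hm hq1.le).trans_lt hx
  have hmarkov : x * μ.real {y | x ≤ y} ≤ m := mul_meas_ge_le_integral_of_nonneg hnonneg hint x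
  have htail : μ.real {y | x ≤ y} ≤ 1 - q := by
    refine le_of_mul_le_mul_left (hmarkov.trans ?_) hx0
    exact ((div_lt_iff₀ hq1).1 hx).le
  have hcompl : 1 - cdf μ x = μ.real (Set.Ioi x) := by
    rw [cdf_eq_real, ← probReal_compl_eq_one_sub measurableSet_Iic, Set.compl_Iic]
  have hmono : μ.real (Set.Ioi x) ≤ μ.real {y | x ≤ y} :=
    measureReal_mono Set.Ioi_subset_Ici_self
  linarith

end Quantile

section StandardNormal

lemma strictMono_cdf_gaussianReal : StrictMono (cdf (gaussianReal 0 1)) := by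
  intro x y hxy
  refine (monotone_cdf _ hxy.le).lt_of_ne fun h => ?_
  have hnull : (gaussianReal 0 1) (Set.Ioc x y) = 0 := by
    rw [← measure_cdf (gaussianReal 0 1), StieltjesFunction.measure_Ioc, h, sub_self,
      ENNReal.ofReal_zero]
  have hvol := gaussianReal_absolutelyContinuous' 0 one_ne_zero hnull
  rw [Real.volume_Ioc, ENNReal.ofReal_eq_zero] at hvol
  linarith

lemma cdf_gaussianReal_neg (x : ℝ) :
    cdf (gaussianReal 0 1) (-x) = 1 - cdf (gaussianReal 0 1) x := by
  have : NullSingletonClass (gaussianReal 0 1) := nullSingletonClass_gaussianReal one_ne_zero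
  have hneg : (gaussianReal 0 1).map (fun y => -y) = gaussianReal 0 1 := by
    simpa using gaussianReal_map_neg (μ := 0) (v := 1)
  calc cdf (gaussianReal 0 1) (-x)
      = ((gaussianReal 0 1).map fun y => -y).real (Set.Iic (-x)) := by rw [hneg, cdf_eq_real]
    _ = (gaussianReal 0 1).real (Set.Ici x) := by
      rw [map_measureReal_apply measurable_neg measurableSet_Iic]
      simp
    _ = (gaussianReal 0 1).real (Set.Iic x)ᶜ := by
      rw [Set.compl_Iic]
      exact measureReal_congr Ioi_ae_eq_Ici.symm
    _ = 1 - cdf (gaussianReal 0 1) x := by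
      rw [probReal_compl_eq_one_sub measurableSet_Iic, cdf_eq_real]

lemma cdf_gaussianReal_zero : cdf (gaussianReal 0 1) 0 = 1 / 2 := by
  have h := cdf_gaussianReal_neg 0
  rw [neg_zero] at h
  linarith

lemma quantile_gaussianReal_pos {q : ℝ} (hq : q ∈ Set.Ioo (1 / 2 : ℝ) 1) :
    0 < quantile (gaussianReal 0 1) q := by
  rw [lt_quantile_iff ⟨one_half_pos.trans hq.1, hq.2⟩, cdf_gaussianReal_zero]
  exact hq.1

end StandardNormal

section ChiSquared

instance isProbabilityMeasure_chiSquared (k : ℕ) : IsProbabilityMeasure (chiSquared k) :=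
  Measure.isProbabilityMeasure_map (Measurable.aemeasurable (by fun_prop))

section Product

variable {ι Ω : Type*} [Fintype ι] [MeasurableSpace Ω] {μ : Measure Ω} [IsProbabilityMeasure μ]
  {f : Ω → ℝ}

lemma integrable_pi_sum_comp_eval (hf : Integrable f μ) :
    Integrable (fun y : ι → Ω => ∑ i, f (y i)) (Measure.pi fun _ => μ) :=
  integrable_finsetSum _ fun _ _ => integrable_comp_eval (μ := fun _ : ι => μ) hf

lemma integral_pi_sum_comp_eval (hf : Integrable f μ) :
    ∫ y : ι → Ω, ∑ i, f (y i) ∂(Measure.pi fun _ => μ) = Fintype.card ι * ∫ x, f x ∂μ := by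
  rw [integral_finsetSum _ fun _ _ => integrable_comp_eval (μ := fun _ : ι => μ) hf]
  simp only [integral_comp_eval (μ := fun _ : ι => μ) hf.aestronglyMeasurable, Finset.sum_const,
    Finset.card_univ, nsmul_eq_mul]

/-- Markov's inequality for the number of indices `i` with `Y (y i) ≤ 2 * c`: if these are fewer
than half of the indices, then the values `Y (y i)` sum to more than `c * card ι`. -/
lemma measureReal_pi_sum_le {Y : Ω → ℝ} (hY : Measurable Y) (hnonneg : ∀ x, 0 ≤ Y x) {c : ℝ}
    (hc : 0 < c) [Nonempty ι] :
    (Measure.pi fun _ : ι => μ).real {y | ∑ i, Y (y i) ≤ c * Fintype.card ι} ≤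
      2 * μ.real {x | Y x ≤ 2 * c} := by
  set ν := Measure.pi fun _ : ι => μ
  set A := {x | Y x ≤ 2 * c}
  set φ : Ω → ℝ := A.indicator 1
  set k : ℝ := (Fintype.card ι : ℝ)
  have : 0 < k := Nat.cast_pos.2 Fintype.card_pos
  have hA : MeasurableSet A := measurableSet_le hY measurable_const
  have hφ : Integrable φ μ := (integrable_const 1).indicator hA
  have hφ_nonneg (x : Ω) : 0 ≤ φ x := Set.indicator_nonneg (fun _ _ => zero_le_one) x
  have hφ_le (x : Ω) : 2 * c * (1 - φ x) ≤ Y x := by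
    by_cases hx : x ∈ A
    · simpa [φ, hx] using hnonneg x
    · simpa [φ, hx] using (not_le.1 hx).le
  have hsubset : {y : ι → Ω | ∑ i, Y (y i) ≤ c * k} ⊆ {y | k / 2 ≤ ∑ i, φ (y i)} := by
    intro y (hy : ∑ i, Y (y i) ≤ c * k)
    have hsum : ∑ i, 2 * c * (1 - φ (y i)) ≤ c * k :=
      (Finset.sum_le_sum fun i _ => hφ_le (y i)).trans hy
    rw [← Finset.mul_sum, Finset.sum_sub_distrib, Finset.sum_const, Finset.card_univ,
      nsmul_one] at hsum
    have : 2 * (k - ∑ i, φ (y i)) ≤ k := le_of_mul_le_mul_left (by linarith) hc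
    change k / 2 ≤ ∑ i, φ (y i)
    linarith
  have hmarkov : k / 2 * ν.real {y | k / 2 ≤ ∑ i, φ (y i)} ≤ k * μ.real A := by
    rw [← integral_indicator_one hA, ← integral_pi_sum_comp_eval hφ]
    exact mul_meas_ge_le_integral_of_nonneg
      (ae_of_all _ fun y => Finset.sum_nonneg fun i _ => hφ_nonneg (y i))
      (integrable_pi_sum_comp_eval hφ) _
  refine (measureReal_mono hsubset).trans (le_of_mul_le_mul_left (a := k / 2) ?_ (by positivity))
  linarith

end Product

lemma integrable_sq_gaussianReal : Integrable (fun x => x ^ 2) (gaussianReal 0 1) :=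
  (IsGaussian.memLp_two_id (μ := gaussianReal 0 1)).integrable_sq

lemma integral_sq_gaussianReal : ∫ x, x ^ 2 ∂(gaussianReal 0 1) = 1 := by
  have h := variance_id_gaussianReal (μ := 0) (v := 1)
  rw [variance_of_integral_eq_zero (by fun_prop) (by simp)] at h
  simpa using h

lemma integral_id_chiSquared (k : ℕ) : ∫ x, x ∂(chiSquared k) = k := by
  rw [chiSquared, integral_map (Measurable.aemeasurable (by fun_prop)) (by fun_prop),
    integral_pi_sum_comp_eval integrable_sq_gaussianReal, integral_sq_gaussianReal, mul_one,
    Fintype.card_fin]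

lemma quantile_chiSquared_le {q : ℝ} (hq : q ∈ Set.Ioo (0 : ℝ) 1) (k : ℕ) :
    quantile (chiSquared k) q ≤ k / (1 - q) := by
  rw [← integral_id_chiSquared k]
  refine quantile_le_integral_div hq ?_ ?_
  · refine (ae_map_iff (Measurable.aemeasurable (by fun_prop)) measurableSet_Ici).2 <|
      ae_of_all _ fun y => ?_
    exact Finset.sum_nonneg fun i _ => sq_nonneg (y i)
  · rw [chiSquared, integrable_map_measure (by fun_prop)
      (Measurable.aemeasurable (by fun_prop))]
    exact integrable_pi_sum_comp_eval integrable_sq_gaussianReal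

lemma exists_forall_mul_lt_quantile_chiSquared {q : ℝ} (hq : q ∈ Set.Ioo (0 : ℝ) 1) :
    ∃ b : ℝ, 0 < b ∧ ∀ k : ℕ, 0 < k → b * k < quantile (chiSquared k) q := by
  have : NullSingletonClass (gaussianReal 0 1) := nullSingletonClass_gaussianReal one_ne_zero
  have hsmall : Tendsto (fun δ => (gaussianReal 0 1).real (Set.Icc (0 - δ) (0 + δ)))
      (𝓝[>] 0) (𝓝 0) := by
    simpa [Function.comp_def, measureReal_def] using
      ((ENNReal.tendsto_toReal ENNReal.zero_ne_top).comp
        (tendsto_measure_Icc (gaussianReal 0 1) 0)).mono_left nhdsWithin_le_nhds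
  obtain ⟨δ, hδ, hδ0⟩ := ((hsmall.eventually_lt_const (half_pos hq.1)).and
    self_mem_nhdsWithin).exists
  have hδ0 : 0 < δ := hδ0
  refine ⟨δ ^ 2 / 2, by positivity, fun k hk => (lt_quantile_iff hq).2 ?_⟩
  have : Nonempty (Fin k) := ⟨⟨0, hk⟩⟩
  have hsq : {x : ℝ | x ^ 2 ≤ 2 * (δ ^ 2 / 2)} = Set.Icc (0 - δ) (0 + δ) := by
    ext x
    rw [Set.mem_ofPred_eq, mul_div_cancel₀ _ two_ne_zero, sq_le_sq, abs_of_pos hδ0, abs_le,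
      zero_sub, zero_add, Set.mem_Icc]
  calc cdf (chiSquared k) (δ ^ 2 / 2 * k)
      = (Measure.pi fun _ : Fin k => gaussianReal 0 1).real
          {y | ∑ i, y i ^ 2 ≤ δ ^ 2 / 2 * Fintype.card (Fin k)} := by
        rw [cdf_eq_real, chiSquared, map_measureReal_apply (by fun_prop) measurableSet_Iic,
          Fintype.card_fin]
        rfl
    _ ≤ 2 * (gaussianReal 0 1).real {x | x ^ 2 ≤ 2 * (δ ^ 2 / 2)} :=
        measureReal_pi_sum_le (Y := fun x : ℝ => x ^ 2) (by fun_prop) sq_nonneg (by positivity)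
    _ < q := by
        rw [hsq]
        linarith

lemma exists_radiusRatio_bounds {α : ℝ} (hα : α ∈ Set.Ioo (0 : ℝ) (1 / 2)) :
    ∃ c c' : ℝ, 0 < c ∧ ∀ S : ℕ, 2 ≤ S →
      c * √(S : ℝ) < radiusRatio S α ∧ radiusRatio S α ≤ c' * √(S : ℝ) := by
  have hq : 1 - α ∈ Set.Ioo (0 : ℝ) 1 := ⟨by linarith [hα.2], by linarith [hα.1]⟩
  obtain ⟨b, hb, hbk⟩ := exists_forall_mul_lt_quantile_chiSquared hq
  set z := quantile (gaussianReal 0 1) (1 - α)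
  have hz : 0 < z := quantile_gaussianReal_pos ⟨by linarith [hα.2], hq.2⟩
  refine ⟨√(b / 2) / z, √(1 / α) / z, by positivity, fun S hS => ?_⟩
  have hS1 : ((S - 1 : ℕ) : ℝ) = S - 1 := Nat.cast_pred (by omega)
  have hS2 : (2 : ℝ) ≤ S := by exact_mod_cast hS
  rw [radiusRatio, div_mul_eq_mul_div, div_mul_eq_mul_div, ← Real.sqrt_mul (by positivity),
    ← Real.sqrt_mul (one_div_nonneg.2 hα.1.le)]
  constructor
  · have hlower : b / 2 * S < quantile (chiSquared (S - 1)) (1 - α) := by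
      refine lt_of_le_of_lt ?_ (hbk (S - 1) (by omega))
      rw [hS1]
      nlinarith
    gcongr
  · have hupper : quantile (chiSquared (S - 1)) (1 - α) ≤ 1 / α * S := by
      refine (quantile_chiSquared_le hq _).trans ?_
      rw [hS1, sub_sub_cancel, one_div_mul_eq_div]
      gcongr
      · exact hα.1.le
      · linarith
    gcongr

end ChiSquared


section SetLimits

variable {E F : Type*} [TopologicalSpace E] [TopologicalSpace F] {C D : ℕ → Set E} {L K : Set E}

lemma innerLim_subset_outerLim : innerLim C ⊆ outerLim C := fun _ hx U hU => (hx U hU).frequently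

lemma outerLim_eq_iInter_closure : outerLim C = ⋂ n, closure (⋃ m ≥ n, C m) := by
  ext x
  simp only [outerLim, frequently_atTop, Set.mem_iInter, mem_closure_iff_nhds]
  constructor
  · intro hx n U hU
    obtain ⟨m, hnm, y, hyC, hyU⟩ := hx U hU n
    exact ⟨y, hyU, Set.mem_biUnion hnm hyC⟩
  · intro hx U hU n
    obtain ⟨y, hyU, hy⟩ := hx n U hU
    obtain ⟨m, hnm, hyC⟩ := Set.mem_iUnion₂.1 hy
    exact ⟨m, hnm, y, hyC, hyU⟩

lemma isClosed_innerLim : IsClosed (innerLim C) := by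
  refine isClosed_of_closure_subset fun x hx U hU => ?_
  obtain ⟨y, hyU, hy⟩ := mem_closure_iff_nhds.1 hx (interior U) (interior_mem_nhds.2 hU)
  exact hy U (mem_interior_iff_mem_nhds.1 hyU)

lemma mem_innerLim_of_eventually_mem {x : E} (h : ∀ᶠ N in atTop, x ∈ C N) : x ∈ innerLim C :=
  fun _ hU => h.mono fun _ hx => ⟨x, hx, mem_of_mem_nhds hU⟩

lemma outerLim_subset_of_eventually_subset (hK : IsClosed K) (h : ∀ᶠ N in atTop, C N ⊆ K) :
    outerLim C ⊆ K := by
  obtain ⟨n, hn⟩ := eventually_atTop.1 h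
  rw [outerLim_eq_iInter_closure]
  exact (Set.iInter_subset _ n).trans (closure_minimal (Set.iUnion₂_subset hn) hK)

lemma setTendsto_of_subset (hinner : L ⊆ innerLim C) (houter : outerLim C ⊆ L) :
    SetTendsto C L :=
  ⟨(innerLim_subset_outerLim.trans houter).antisymm hinner,
    houter.antisymm (hinner.trans innerLim_subset_outerLim)⟩

lemma SetTendsto.congr' (h : SetTendsto C L) (hCD : ∀ᶠ N in atTop, C N = D N) :
    SetTendsto D L := by
  refine setTendsto_of_subset (fun x hx U hU => ?_) fun x hx => ?_
  · rw [← h.1] at hx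
    filter_upwards [hx U hU, hCD] with N hN hN'
    rwa [← hN']
  · rw [← h.2]
    exact fun U hU => ((hx U hU).and_eventually hCD).mono fun N hN => hN.2 ▸ hN.1

lemma SetTendsto.image (h : SetTendsto C L) (f : E ≃ₜ F) :
    SetTendsto (fun N => f '' C N) (f '' L) := by
  refine setTendsto_of_subset ?_ fun y hy => ⟨f.symm y, ?_, f.apply_symm_apply y⟩
  · rintro _ ⟨x, hx, rfl⟩ U hU
    rw [← h.1] at hx
    filter_upwards [hx _ (f.continuous.continuousAt hU)] with N hN
    rwa [← Set.image_inter_preimage, Set.image_nonempty]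
  · rw [← h.2]
    intro U hU
    refine (hy _ (f.symm.continuous.continuousAt hU)).mono fun N hN => ?_
    rwa [← f.image_eq_preimage_symm, ← Set.image_inter f.injective, Set.image_nonempty] at hN

lemma setTendsto_const (hK : IsClosed K) : SetTendsto (fun _ => K) K :=
  setTendsto_of_subset (fun _ hx => mem_innerLim_of_eventually_mem (.of_forall fun _ => hx))
    (outerLim_subset_of_eventually_subset hK (.of_forall fun _ => subset_rfl))

lemma SetTendsto.const_smul [Zero E] [T1Space E] {𝕜 : Type*} [GroupWithZero 𝕜]
    [MulActionWithZero 𝕜 E] [ContinuousConstSMul 𝕜 E] (h : SetTendsto C L) (hL : L.Nonempty)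
    (ξ : 𝕜) : SetTendsto (fun N => ξ • C N) (ξ • L) := by
  rcases eq_or_ne ξ 0 with rfl | hξ
  · obtain ⟨x, hx⟩ := hL
    rw [Set.zero_smul_set ⟨x, hx⟩]
    refine (setTendsto_const isClosed_singleton).congr' ?_
    rw [← h.1] at hx
    filter_upwards [hx Set.univ univ_mem] with N hN
    rw [Set.zero_smul_set (hN.mono Set.inter_subset_left), Set.singleton_zero]
  · exact h.image (Homeomorph.smulOfNeZero ξ hξ)

end SetLimits

section Portmanteau

variable {E V ι Ω' : Type*} {Ω : ι → Type*} [TopologicalSpace E] [MeasurableSpace E]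
  [OpensMeasurableSpace E] [HasOuterApproxClosed E] [TopologicalSpace V]
  [∀ i, MeasurableSpace (Ω i)] [MeasurableSpace Ω'] {l : Filter ι} {X : (i : ι) → Ω i → E}
  {Z : Ω' → E} {μ : (i : ι) → Measure (Ω i)} [∀ i, IsProbabilityMeasure (μ i)] {P : Measure Ω'}
  [IsProbabilityMeasure P] {q : ℝ}

lemma eventually_real_preimage_lt (h : TendstoInDistribution X l Z μ P) {F : Set E}
    (hF : IsClosed F) (hq : P.real (Z ⁻¹' F) < q) : ∀ᶠ i in l, (μ i).real (X i ⁻¹' F) < q := by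
  have hlimsup := ProbabilityMeasure.limsup_measure_closed_le_of_tendsto h.tendsto hF
  simp only [ProbabilityMeasure.coe_mk,
    Measure.map_apply_of_aemeasurable h.aemeasurable_limit hF.measurableSet,
    Measure.map_apply_of_aemeasurable (h.forall_aemeasurable _) hF.measurableSet] at hlimsup
  have hlt : P (Z ⁻¹' F) < ENNReal.ofReal q :=
    (ENNReal.lt_ofReal_iff_toReal_lt (measure_ne_top _ _)).2 hq
  filter_upwards [eventually_lt_of_limsup_lt (hlimsup.trans_lt hlt)] with i hi
  exact (ENNReal.lt_ofReal_iff_toReal_lt (measure_ne_top _ _)).1 hi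

lemma eventually_lt_real_preimage (h : TendstoInDistribution X l Z μ P) {G : Set E}
    (hG : IsOpen G) (hq : q < P.real (Z ⁻¹' G)) : ∀ᶠ i in l, q < (μ i).real (X i ⁻¹' G) := by
  have hcompl : P.real (Z ⁻¹' Gᶜ) < 1 - q := by
    rw [Set.preimage_compl, probReal_compl_eq_one_sub₀
      (h.aemeasurable_limit.nullMeasurable hG.measurableSet)]
    linarith
  filter_upwards [eventually_real_preimage_lt h hG.isClosed_compl hcompl] with i hi
  rw [Set.preimage_compl, probReal_compl_eq_one_sub₀
    ((h.forall_aemeasurable i).nullMeasurable hG.measurableSet)] at hi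
  linarith

lemma exists_eventually_real_preimage_lt (h : TendstoInDistribution X l Z μ P) {F : ℕ → Set E}
    (hF : ∀ n, IsClosed (F n)) (hanti : Antitone F) (hq : P.real (Z ⁻¹' ⋂ n, F n) < q) :
    ∃ n, ∀ᶠ i in l, (μ i).real (X i ⁻¹' F n) < q := by
  have htendsto : Tendsto (fun n => P.real (Z ⁻¹' F n)) atTop (𝓝 (P.real (Z ⁻¹' ⋂ n, F n))) := by
    rw [Set.preimage_iInter]
    exact (ENNReal.tendsto_toReal (measure_ne_top _ _)).comp <| tendsto_measure_iInter_atTop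
      (fun n => h.aemeasurable_limit.nullMeasurable (hF n).measurableSet)
      (fun m n hmn => Set.preimage_mono (hanti hmn)) ⟨0, measure_ne_top _ _⟩
  obtain ⟨n, hn⟩ := (htendsto.eventually_lt_const hq).exists
  exact ⟨n, eventually_real_preimage_lt h (hF n) hn⟩

lemma eventually_forall_mem_real_lt [FirstCountableTopology V]
    (h : TendstoInDistribution X l Z μ P) {G : Set (E × V)} (hG : IsClosed G) {K : Set V}
    (hK : IsCompact K) (hq : ∀ v ∈ K, P.real {ω | (Z ω, v) ∈ G} < q) :
    ∀ᶠ i in l, ∀ v ∈ K, (μ i).real {ω | (X i ω, v) ∈ G} < q := by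
  refine hK.induction_on (p := fun s => ∀ᶠ i in l, ∀ v ∈ s, (μ i).real {ω | (X i ω, v) ∈ G} < q)
    (by simp) (fun s t hst ht => ht.mono fun i hi v hv => hi v (hst hv))
    (fun s t hs ht => ?_) fun v hv => ?_
  · filter_upwards [hs, ht] with i hsi hti v hv using hv.elim (hsi v) (hti v)
  obtain ⟨U, hU⟩ := (𝓝 v).exists_antitone_basis
  set F : ℕ → Set E := fun n => closure {x | ∃ w ∈ U n, (x, w) ∈ G}
  have hanti : Antitone F := fun m n hmn =>
    closure_mono fun x ⟨w, hw, hxw⟩ => ⟨w, hU.antitone hmn hw, hxw⟩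
  have hinter : ⋂ n, F n ⊆ {x | (x, v) ∈ G} := fun x hx => by
    refine hG.closure_subset (mem_closure_iff_nhds.2 fun t ht => ?_)
    obtain ⟨A, hA, B, hB, hAB⟩ := mem_nhds_prod_iff.1 ht
    obtain ⟨n, hn⟩ := hU.mem_iff.1 hB
    obtain ⟨y, hyA, w, hw, hyw⟩ := mem_closure_iff_nhds.1 (Set.mem_iInter.1 hx n) A hA
    exact ⟨(y, w), hAB ⟨hyA, hn hw⟩, hyw⟩
  obtain ⟨n, hn⟩ := exists_eventually_real_preimage_lt h (fun n => isClosed_closure) hanti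
    ((measureReal_mono (Set.preimage_mono hinter)).trans_lt (hq v hv))
  refine ⟨U n, mem_nhdsWithin_of_mem_nhds (hU.mem n), hn.mono fun i hi w hw => ?_⟩
  have hsubset : {x | (x, w) ∈ G} ⊆ F n := fun x hx => subset_closure ⟨w, hw, hx⟩
  exact (measureReal_mono (Set.preimage_mono hsubset)).trans_lt hi

end Portmanteau

section OuterLimit

variable {E Ω' : Type*} {Ω : ℕ → Type*} [TopologicalSpace E] [MeasurableSpace E]
  [OpensMeasurableSpace E] [HasOuterApproxClosed E] [∀ N, MeasurableSpace (Ω N)]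
  [MeasurableSpace Ω'] {X : (N : ℕ) → Ω N → E} {Z : Ω' → E} {μ : (N : ℕ) → Measure (Ω N)}
  [∀ N, IsProbabilityMeasure (μ N)] {P : Measure Ω'} [IsProbabilityMeasure P] {q : ℝ}

lemma le_real_preimage_outerLim (h : TendstoInDistribution X atTop Z μ P) {C : ℕ → Set E}
    (hC : ∀ N, q ≤ (μ N).real (X N ⁻¹' C N)) : q ≤ P.real (Z ⁻¹' outerLim C) := by
  by_contra! hq
  rw [outerLim_eq_iInter_closure] at hq
  have hanti : Antitone fun n => closure (⋃ m ≥ n, C m) := fun m n hmn =>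
    closure_mono (Set.biUnion_mono (fun k hk => le_trans hmn hk) fun _ _ => subset_rfl)
  obtain ⟨n, hn⟩ := exists_eventually_real_preimage_lt h (fun n => isClosed_closure) hanti hq
  obtain ⟨N, hN, hnN⟩ := (hn.and (eventually_ge_atTop n)).exists
  have hsubset : C N ⊆ closure (⋃ m ≥ n, C m) :=
    (Set.subset_biUnion_of_mem (u := C) (show N ∈ {m | m ≥ n} from hnN)).trans subset_closure
  exact ((hC N).trans (measureReal_mono (Set.preimage_mono hsubset))).not_gt hN

end OuterLimit

section FloatingBody

variable {E Ω : Type*} [NormedAddCommGroup E] [InnerProductSpace ℝ E] [MeasurableSpace Ω]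
  {μ : Measure Ω} {X : Ω → E} {q : ℝ}

/-- The convex floating body of the random vector `X` at level `q`: the intersection of all closed
half-spaces that contain `X` with probability at least `q`. -/
def floatingBody (μ : Measure Ω) (X : Ω → E) (q : ℝ) : Set E :=
  {x | ∀ (v : E) (t : ℝ), q ≤ μ.real {ω | t ≤ ⟪X ω, v⟫} → t ≤ ⟪x, v⟫}

lemma exists_forall_lt_inner_of_notMem [CompleteSpace E] {K : Set E} (hconvex : Convex ℝ K)
    (hclosed : IsClosed K) {x : E} (hx : x ∉ K) :
    ∃ (v : E) (u : ℝ), ⟪x, v⟫ < u ∧ ∀ y ∈ K, u < ⟪y, v⟫ := by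
  obtain ⟨f, u, hxu, hu⟩ := geometric_hahn_banach_point_closed hconvex hclosed hx
  have hf (y : E) : ⟪y, (InnerProductSpace.toDual ℝ E).symm f⟫ = f y := by
    rw [real_inner_comm, InnerProductSpace.toDual_symm_apply]
  exact ⟨_, u, (hf x).trans_lt hxu, fun y hy => (hu y hy).trans_eq (hf y).symm⟩

lemma floatingBody_subset_of_ae_mem [CompleteSpace E] [IsProbabilityMeasure μ] (hq : q ≤ 1)
    {K : Set E} (hconvex : Convex ℝ K) (hclosed : IsClosed K) (hX : ∀ᵐ ω ∂μ, X ω ∈ K) :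
    floatingBody μ X q ⊆ K := by
  intro x hx
  by_contra hxK
  obtain ⟨v, u, hxu, hu⟩ := exists_forall_lt_inner_of_notMem hconvex hclosed hxK
  have hmass : {ω | u ≤ ⟪X ω, v⟫} =ᵐ[μ] Set.univ :=
    eventuallyEq_univ.2 (hX.mono fun ω hω => (hu _ hω).le)
  refine (hx v u ?_).not_gt hxu
  rwa [measureReal_congr hmass, probReal_univ]

lemma floatingBody_smul_sub {c : ℝ} (hc : 0 < c) (p : E) :
    floatingBody μ (fun ω => c • (X ω - p)) q = (fun y => c • (y - p)) '' floatingBody μ X q := by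
  have hinner (y v : E) (t : ℝ) : t ≤ ⟪c • (y - p), v⟫ ↔ c⁻¹ * t + ⟪p, v⟫ ≤ ⟪y, v⟫ := by
    rw [real_inner_smul_left, inner_sub_left, ← inv_mul_le_iff₀ hc, le_sub_iff_add_le]
  have hmem (y : E) :
      c • (y - p) ∈ floatingBody μ (fun ω => c • (X ω - p)) q ↔ y ∈ floatingBody μ X q := by
    simp only [floatingBody, Set.mem_ofPred_eq, hinner]
    refine ⟨fun h v t => ?_, fun h v t => h v _⟩
    simpa [hc.ne'] using h v (c * (t - ⟪p, v⟫))
  ext y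
  refine ⟨fun hy => ?_, ?_⟩
  · obtain ⟨x, rfl⟩ : ∃ x, c • (x - p) = y := ⟨c⁻¹ • y + p, by simp [hc.ne']⟩
    exact ⟨x, (hmem x).1 hy, rfl⟩
  · rintro ⟨x, hx, rfl⟩
    exact (hmem x).2 hx

lemma mem_floatingBody_of_ae_mem [IsFiniteMeasure μ] (hq : 0 < q) {W : Submodule ℝ E}
    [W.HasOrthogonalProjection] (hX : ∀ᵐ ω ∂μ, X ω ∈ W) {x : E} (hx : x ∈ W)
    (hmass : ∀ v ∈ W, v ≠ 0 → μ.real {ω | ⟪x, v⟫ ≤ ⟪X ω, v⟫} < q) : x ∈ floatingBody μ X q := by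
  intro v t ht
  by_contra! hxt
  set w := W.starProjection v
  have hinner {y : E} (hy : y ∈ W) : ⟪y, v⟫ = ⟪y, w⟫ := by
    rw [← W.inner_starProjection_left_eq_right, W.starProjection_eq_self_iff.2 hy]
  have hae : {ω | t ≤ ⟪X ω, v⟫} =ᵐ[μ] {ω | t ≤ ⟪X ω, w⟫} := by
    filter_upwards [hX] with ω hω
    exact congrArg (t ≤ ·) (hinner hω)
  rw [measureReal_congr hae] at ht
  rw [hinner hx] at hxt
  rcases eq_or_ne w 0 with hw | hw
  · simp only [hw, inner_zero_right] at hxt ht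
    simp only [hxt.not_ge, Set.ofPred_false, measureReal_empty] at ht
    exact ht.not_gt hq
  · have hsubset : {ω | t ≤ ⟪X ω, w⟫} ⊆ {ω | ⟪x, w⟫ ≤ ⟪X ω, w⟫} := fun ω hω => hxt.le.trans hω
    exact (ht.trans (measureReal_mono hsubset)).not_gt
      (hmass w (W.starProjection_apply_mem v) hw)

end FloatingBody

section FloatingBodyLimit

variable {E ι Ω' : Type*} {Ω : ι → Type*} [NormedAddCommGroup E] [InnerProductSpace ℝ E]
  [MeasurableSpace E] [BorelSpace E] [∀ i, MeasurableSpace (Ω i)] [MeasurableSpace Ω']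
  {l : Filter ι} {X : (i : ι) → Ω i → E} {Z : Ω' → E} {μ : (i : ι) → Measure (Ω i)}
  [∀ i, IsProbabilityMeasure (μ i)] {P : Measure Ω'} [IsProbabilityMeasure P] {q : ℝ}

lemma eventually_mem_floatingBody [FiniteDimensional ℝ E] (h : TendstoInDistribution X l Z μ P)
    (hq : 0 < q) {W : Submodule ℝ E} (hX : ∀ i, ∀ᵐ ω ∂(μ i), X i ω ∈ W) {x : E} (hx : x ∈ W)
    (hmass : ∀ v ∈ W, v ≠ 0 → P.real {ω | ⟪x, v⟫ ≤ ⟪Z ω, v⟫} < q) :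
    ∀ᶠ i in l, x ∈ floatingBody (μ i) (X i) q := by
  have hcompact : IsCompact (sphere (0 : E) 1 ∩ W) :=
    (isCompact_sphere 0 1).inter_right W.closed_of_finiteDimensional
  have hclosed : IsClosed {p : E × E | ⟪x, p.2⟫ ≤ ⟪p.1, p.2⟫} :=
    isClosed_le (by fun_prop) (by fun_prop)
  have hunit := eventually_forall_mem_real_lt h hclosed hcompact
    fun v hv => hmass v hv.2 (ne_of_mem_sphere hv.1 one_ne_zero)
  filter_upwards [hunit] with i hi
  refine mem_floatingBody_of_ae_mem hq (hX i) hx fun v hv hv0 => ?_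
  have hnorm : 0 < ‖v‖⁻¹ := inv_pos.2 (norm_pos_iff.2 hv0)
  have hsphere : ‖v‖⁻¹ • v ∈ sphere (0 : E) 1 := by
    simpa using norm_smul_inv_norm (𝕜 := ℝ) hv0
  simpa only [real_inner_smul_right, Set.mem_ofPred_eq, mul_le_mul_iff_right₀ hnorm] using
    hi _ ⟨hsphere, W.smul_mem _ hv⟩

end FloatingBodyLimit

section FloatingBodyOuterLimit

variable {E Ω' : Type*} {Ω : ℕ → Type*} [NormedAddCommGroup E] [InnerProductSpace ℝ E]
  [MeasurableSpace E] [BorelSpace E] [∀ N, MeasurableSpace (Ω N)] [MeasurableSpace Ω']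
  {X : (N : ℕ) → Ω N → E} {Z : Ω' → E} {μ : (N : ℕ) → Measure (Ω N)}
  [∀ N, IsProbabilityMeasure (μ N)] {P : Measure Ω'} [IsProbabilityMeasure P] {q : ℝ}

lemma outerLim_floatingBody_subset (h : TendstoInDistribution X atTop Z μ P) {v : E} {t : ℝ}
    (hq : q < P.real {ω | t < ⟪Z ω, v⟫}) :
    outerLim (fun N => floatingBody (μ N) (X N) q) ⊆ {x | t ≤ ⟪x, v⟫} := by
  have hopen : IsOpen {x : E | t < ⟪x, v⟫} := isOpen_lt continuous_const (by fun_prop)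
  refine outerLim_subset_of_eventually_subset (isClosed_le continuous_const (by fun_prop)) ?_
  filter_upwards [eventually_lt_real_preimage h hopen hq] with N hN x hx
  have hsubset : X N ⁻¹' {x | t < ⟪x, v⟫} ⊆ {ω | t ≤ ⟪X N ω, v⟫} :=
    fun ω (hω : t < ⟪X N ω, v⟫) => hω.le
  exact hx v t (hN.le.trans (measureReal_mono hsubset))

end FloatingBodyOuterLimit

section ValueAtRisk

lemma valueAtRisk_le_iff {Ω : Type*} [MeasurableSpace Ω] {μ : Measure Ω} [IsProbabilityMeasure μ]
    {X : Ω → ℝ} (hX : AEMeasurable X μ) {α : ℝ} (hα : α ∈ Set.Ioo (0 : ℝ) 1) {b : ℝ} :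
    valueAtRisk μ α X ≤ b ↔ ∀ t, 1 - α ≤ μ.real {ω | t ≤ X ω} → t ≤ b := by
  have := Measure.isProbabilityMeasure_map hX.neg
  have hset : {t | 1 - α ≤ μ.real {ω | t ≤ X ω}} = -{x | 1 - α ≤ cdf (μ.map (-X)) x} := by
    ext t
    simp only [Set.mem_neg, Set.mem_ofPred_eq, cdf_eq_real,
      map_measureReal_apply_of_aemeasurable hX.neg measurableSet_Iic, Set.preimage, Set.mem_Iic,
      Pi.neg_apply, neg_le_neg_iff]
  have hbdd : BddAbove {t | 1 - α ≤ μ.real {ω | t ≤ X ω}} := by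
    rw [hset]
    exact (bddBelow_setOf_le_cdf (sub_pos.2 hα.2)).neg
  have hne : {t | 1 - α ≤ μ.real {ω | t ≤ X ω}}.Nonempty := by
    rw [hset]
    exact (nonempty_setOf_le_cdf (sub_lt_self 1 hα.1)).neg
  exact csSup_le_iff hbdd hne

lemma convex_simplex (S : ℕ) : Convex ℝ (simplex S) :=
  (convex_stdSimplex ℝ (Fin S)).linear_preimage
    (EuclideanSpace.equiv (Fin S) ℝ : Vec S →ₗ[ℝ] Fin S → ℝ)

lemma isClosed_simplex (S : ℕ) : IsClosed (simplex S) :=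
  (isClosed_stdSimplex ℝ (Fin S)).preimage (EuclideanSpace.equiv (Fin S) ℝ).continuous

variable {S A : ℕ} {s : Fin S} {a : Fin A}

lemma varSet_eq_floatingBody {μ : Measure (Model S A)} [IsProbabilityMeasure μ] {α : ℝ}
    (hα : α ∈ Set.Ioo (0 : ℝ) 1) (hμ : ∀ᵐ P ∂μ, P s a ∈ simplex S) :
    varSet μ α s a = floatingBody μ (fun P => P s a) (1 - α) := by
  have hmeas (v : Vec S) : AEMeasurable (fun P : Model S A => ⟪P s a, v⟫) μ :=
    Measurable.aemeasurable (by fun_prop)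
  have hsimplex := floatingBody_subset_of_ae_mem (sub_le_self 1 hα.1.le) (convex_simplex S)
    (isClosed_simplex S) hμ
  ext p
  simp only [varSet, varSetAt, Set.mem_iInter, Set.mem_ofPred_eq, valueAtRisk_le_iff (hmeas _) hα]
  exact ⟨fun h v => (h v).2, fun h v => ⟨hsimplex h, h v⟩⟩

lemma scaled_eq_smul (ξ : ℝ) (C : ℕ → Set (Vec S)) (p : Vec S) (N : ℕ) :
    scaled ξ C p N = ξ • scaled 1 C p N := by
  rw [scaled, scaled, ← Set.image_smul, Set.image_image]
  simp only [mul_one, smul_smul, mul_comm ξ]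

end ValueAtRisk

section Ellipsoid

variable {E F : Type*} [NormedAddCommGroup E] [InnerProductSpace ℝ E] [NormedAddCommGroup F]
  [InnerProductSpace ℝ F]

/-- The image under `T` of the closed ball of radius `r` around `0`: the Mahalanobis ball of radius
`r` of the centered normal distribution with covariance operator `T T†`, including the case in
which this operator is degenerate. -/
def ellipsoid (T : E →L[ℝ] F) (r : ℝ) : Set F :=
  T '' closedBall 0 r

variable {T : E →L[ℝ] F} {r : ℝ}

lemma zero_mem_ellipsoid (hr : 0 ≤ r) : 0 ∈ ellipsoid T r :=
  ⟨0, mem_closedBall_self hr, map_zero T⟩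

lemma convex_ellipsoid : Convex ℝ (ellipsoid T r) :=
  (convex_closedBall 0 r).linear_image (T : E →ₗ[ℝ] F)

lemma isClosed_ellipsoid [ProperSpace E] : IsClosed (ellipsoid T r) :=
  ((isCompact_closedBall 0 r).image T.continuous).isClosed

lemma smul_ellipsoid_subset (ξ : ℝ) : ξ • ellipsoid T r ⊆ ellipsoid T (|ξ| * r) := by
  rintro _ ⟨_, ⟨b, hb, rfl⟩, rfl⟩
  rw [mem_closedBall_zero_iff] at hb
  refine ⟨ξ • b, ?_, map_smul T ξ b⟩
  rw [mem_closedBall_zero_iff, norm_smul, Real.norm_eq_abs]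
  gcongr

lemma exists_mem_ellipsoid_inner_eq [CompleteSpace E] [CompleteSpace F] (hr : 0 ≤ r) (v : F) :
    ∃ y ∈ ellipsoid T r, ⟪y, v⟫ = -(r * ‖(T†) v‖) := by
  set w := (T†) v
  refine ⟨_, ⟨-(r * ‖w‖⁻¹) • w, ?_, rfl⟩, ?_⟩
  · rw [mem_closedBall_zero_iff, norm_smul, norm_neg, Real.norm_of_nonneg (by positivity),
      mul_assoc]
    exact mul_le_of_le_one_right hr inv_mul_le_one
  · rw [← ContinuousLinearMap.adjoint_inner_right, real_inner_smul_left,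
      real_inner_self_eq_norm_sq]
    rcases eq_or_ne w 0 with hw | hw
    · simp [hw]
    · field_simp

lemma preimage_ellipsoid [T.ker.HasOrthogonalProjection] :
    T ⁻¹' ellipsoid T r = {y | ‖T.kerᗮ.orthogonalProjectionOnto y‖ ≤ r} := by
  ext y
  constructor
  · rintro ⟨b, hb, hby⟩
    have hker : y - b ∈ T.ker := by
      rw [LinearMap.mem_ker, map_sub, sub_eq_zero]
      exact hby.symm
    have hproj := T.ker.orthogonalProjectionOnto_orthogonal_apply_eq_zero hker
    rw [map_sub, sub_eq_zero] at hproj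
    rw [Set.mem_ofPred_eq, hproj]
    exact (T.kerᗮ.norm_orthogonalProjectionOnto_apply_le b).trans (mem_closedBall_zero_iff.1 hb)
  · intro hy
    refine ⟨T.kerᗮ.orthogonalProjectionOnto y, mem_closedBall_zero_iff.2 hy, ?_⟩
    have hker : y - T.kerᗮ.starProjection y ∈ T.ker := by
      simpa only [Submodule.orthogonal_orthogonal] using
        T.kerᗮ.sub_starProjection_mem_orthogonal y
    rw [LinearMap.mem_ker, map_sub, sub_eq_zero] at hker
    exact hker.symm

end Ellipsoid

section StandardGaussian

variable {E F : Type*} [NormedAddCommGroup E] [InnerProductSpace ℝ E] [FiniteDimensional ℝ E]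
  [MeasurableSpace E] [BorelSpace E]

lemma stdGaussian_map_orthogonalProjectionOnto (W : Submodule ℝ E) :
    (stdGaussian E).map W.orthogonalProjectionOnto = stdGaussian W := by
  apply Measure.ext_of_charFun
  ext t
  have hinner (x : E) : ⟪W.orthogonalProjectionOnto x, t⟫ = ⟪x, (t : E)⟫ :=
    W.inner_orthogonalProjectionOnto_eq_of_mem_right t x
  rw [charFun_stdGaussian, charFun_apply, integral_map (by fun_prop) (by fun_prop)]
  simp only [hinner]
  rw [← charFun_apply, charFun_stdGaussian, Submodule.coe_norm]

lemma stdGaussian_map_norm_sq :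
    (stdGaussian E).map (fun x => ‖x‖ ^ 2) = chiSquared (Module.finrank ℝ E) := by
  rw [stdGaussian, Measure.map_map (by fun_prop) (by fun_prop), chiSquared]
  congr 1
  ext x
  have hparseval :=
    (stdOrthonormalBasis ℝ E).sum_sq_norm_inner_right (∑ i, x i • stdOrthonormalBasis ℝ E i)
  rw [Function.comp_apply, ← hparseval]
  refine Finset.sum_congr rfl fun i _ => ?_
  rw [(stdOrthonormalBasis ℝ E).orthonormal.inner_right_fintype, Real.norm_eq_abs, sq_abs]

lemma stdGaussian_map_inner (w : E) :
    (stdGaussian E).map (fun y => ⟪w, y⟫) = (gaussianReal 0 1).map (fun x => ‖w‖ * x) := by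
  have h := IsGaussian.map_eq_gaussianReal (μ := stdGaussian E) (innerSL ℝ w)
  rw [variance_dual_stdGaussian, integral_strongDual_stdGaussian, innerSL_apply_norm] at h
  rw [gaussianReal_map_const_mul, mul_zero, mul_one, ← Real.toNNReal_of_nonneg (sq_nonneg ‖w‖)]
  exact h

lemma stdGaussian_real_le_inner {w : E} (hw : w ≠ 0) (r : ℝ) :
    (stdGaussian E).real {y | -(r * ‖w‖) ≤ ⟪y, w⟫} = cdf (gaussianReal 0 1) r := by
  have hpos := norm_pos_iff.2 hw
  calc (stdGaussian E).real {y | -(r * ‖w‖) ≤ ⟪y, w⟫}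
      = ((stdGaussian E).map fun y => ⟪-w, y⟫).real (Set.Iic (r * ‖w‖)) := by
        rw [map_measureReal_apply (by fun_prop) measurableSet_Iic]
        simp only [Set.preimage, Set.mem_Iic, inner_neg_left, neg_le, real_inner_comm w]
    _ = (gaussianReal 0 1).real (Set.Iic r) := by
        rw [stdGaussian_map_inner, norm_neg, map_measureReal_apply (by fun_prop) measurableSet_Iic]
        simp only [Set.preimage, Set.mem_Iic, mul_comm r, mul_le_mul_iff_right₀ hpos]
        rfl
    _ = cdf (gaussianReal 0 1) r := (cdf_eq_real _ r).symm

variable [NormedAddCommGroup F] [InnerProductSpace ℝ F] {T : E →L[ℝ] F} {q r : ℝ}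

lemma stdGaussian_real_preimage_ellipsoid (hr : 0 ≤ r) :
    (stdGaussian E).real (T ⁻¹' ellipsoid T r) =
      cdf (chiSquared (Module.finrank ℝ T.range)) (r ^ 2) := by
  have hfinrank : Module.finrank ℝ T.kerᗮ = Module.finrank ℝ T.range := by
    have h := LinearMap.finrank_range_add_finrank_ker (T : E →ₗ[ℝ] F)
    have h' := T.ker.finrank_add_finrank_orthogonal
    omega
  have hsq : {x : T.kerᗮ | ‖x‖ ≤ r} = (fun x => ‖x‖ ^ 2) ⁻¹' Set.Iic (r ^ 2) := by
    ext x
    exact (sq_le_sq₀ (norm_nonneg x) hr).symm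
  calc (stdGaussian E).real (T ⁻¹' ellipsoid T r)
      = ((stdGaussian E).map T.kerᗮ.orthogonalProjectionOnto).real {x | ‖x‖ ≤ r} := by
        rw [preimage_ellipsoid, map_measureReal_apply (by fun_prop)
          (measurableSet_le (by fun_prop) (by fun_prop))]
        rfl
    _ = (chiSquared (Module.finrank ℝ T.kerᗮ)).real (Set.Iic (r ^ 2)) := by
        rw [stdGaussian_map_orthogonalProjectionOnto, ← stdGaussian_map_norm_sq, hsq,
          map_measureReal_apply (by fun_prop) measurableSet_Iic]
    _ = cdf (chiSquared (Module.finrank ℝ T.range)) (r ^ 2) := by rw [hfinrank, cdf_eq_real]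

variable [CompleteSpace F] {v : F}

lemma stdGaussian_real_inner_le_lt (hq : q ∈ Set.Ioo (0 : ℝ) 1) {b : E}
    (hb : ‖b‖ < quantile (gaussianReal 0 1) q) (hv : v ∈ T.range)
    (hv0 : v ≠ 0) : (stdGaussian E).real {y | ⟪T b, v⟫ ≤ ⟪T y, v⟫} < q := by
  have hw : (T†) v ≠ 0 := by
    obtain ⟨u, hu : T u = v⟩ := hv
    intro hv'
    refine hv0 (inner_self_eq_zero (𝕜 := ℝ).1 ?_)
    nth_rw 1 [← hu]
    rw [← T.adjoint_inner_right, hv', inner_zero_right]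
  have hsubset : {y | ⟪T b, v⟫ ≤ ⟪T y, v⟫} ⊆ {y | -(‖b‖ * ‖(T†) v‖) ≤ ⟪y, (T†) v⟫} := by
    intro y (hy : ⟪T b, v⟫ ≤ ⟪T y, v⟫)
    rw [← T.adjoint_inner_right, ← T.adjoint_inner_right] at hy
    exact (neg_le_of_abs_le (abs_real_inner_le_norm b _)).trans hy
  calc (stdGaussian E).real {y | ⟪T b, v⟫ ≤ ⟪T y, v⟫}
      ≤ (stdGaussian E).real {y | -(‖b‖ * ‖(T†) v‖) ≤ ⟪y, (T†) v⟫} := measureReal_mono hsubset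
    _ = cdf (gaussianReal 0 1) ‖b‖ := stdGaussian_real_le_inner hw _
    _ < q := (lt_quantile_iff hq).1 hb

lemma lt_stdGaussian_real_lt_inner (hq : q ∈ Set.Ioo (0 : ℝ) 1) {t : ℝ}
    (ht : t < -(quantile (gaussianReal 0 1) q * ‖(T†) v‖)) :
    q < (stdGaussian E).real {y | t < ⟪T y, v⟫} := by
  simp only [← T.adjoint_inner_right]
  set w := (T†) v
  rcases eq_or_ne w 0 with hw | hw
  · have ht0 : t < 0 := by simpa [hw] using ht
    simpa [hw, ht0] using hq.2
  · have hz : quantile (gaussianReal 0 1) q < -t / ‖w‖ := by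
      rw [lt_div_iff₀ (norm_pos_iff.2 hw)]
      linarith
    obtain ⟨r, hzr, hrt⟩ := exists_between hz
    rw [lt_div_iff₀ (norm_pos_iff.2 hw)] at hrt
    calc q ≤ cdf (gaussianReal 0 1) (quantile (gaussianReal 0 1) q) :=
          (quantile_le_iff hq).1 le_rfl
      _ < cdf (gaussianReal 0 1) r := strictMono_cdf_gaussianReal hzr
      _ = (stdGaussian E).real {y | -(r * ‖w‖) ≤ ⟪y, w⟫} := (stdGaussian_real_le_inner hw r).symm
      _ ≤ (stdGaussian E).real {y | t < ⟪y, w⟫} :=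
          measureReal_mono fun y hy => (lt_neg_of_lt_neg hrt).trans_le hy

end StandardGaussian

section GaussianLimit

variable {E F : Type*} {Ω : ℕ → Type*} [NormedAddCommGroup E] [InnerProductSpace ℝ E]
  [FiniteDimensional ℝ E] [MeasurableSpace E] [BorelSpace E] [NormedAddCommGroup F]
  [InnerProductSpace ℝ F] [MeasurableSpace F] [BorelSpace F] [∀ N, MeasurableSpace (Ω N)]
  {X : (N : ℕ) → Ω N → F} {μ : (N : ℕ) → Measure (Ω N)} [∀ N, IsProbabilityMeasure (μ N)]
  {T : E →L[ℝ] F} {q : ℝ}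

lemma not_outerLim_subset_ellipsoid (h : TendstoInDistribution X atTop T μ (stdGaussian E))
    (hq : q ∈ Set.Ioo (0 : ℝ) 1) {C : ℕ → Set F} (hC : ∀ N, q ≤ (μ N).real (X N ⁻¹' C N)) {r : ℝ}
    (hr : 0 ≤ r) (hrq : r ^ 2 < quantile (chiSquared (Module.finrank ℝ T.range)) q) :
    ¬ outerLim C ⊆ ellipsoid T r := by
  intro hsubset
  refine ((lt_quantile_iff hq).1 hrq).not_ge ?_
  rw [← stdGaussian_real_preimage_ellipsoid hr]
  exact (le_real_preimage_outerLim h hC).trans (measureReal_mono (Set.preimage_mono hsubset))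

variable [FiniteDimensional ℝ F]

lemma range_le_of_ae_mem (h : TendstoInDistribution X atTop T μ (stdGaussian E))
    {W : Submodule ℝ F} (hX : ∀ N, ∀ᵐ ω ∂(μ N), X N ω ∈ W) : T.range ≤ W := by
  have hmass : 1 ≤ (stdGaussian E).real (T ⁻¹' W) := by
    rw [← (setTendsto_const W.closed_of_finiteDimensional).2]
    refine le_real_preimage_outerLim h fun N => ?_
    have hfull : X N ⁻¹' W =ᵐ[μ N] Set.univ := eventuallyEq_univ.2 (hX N)
    rw [measureReal_congr hfull, probReal_univ]
  rw [← W.orthogonal_orthogonal]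
  rintro _ ⟨y, rfl⟩ v hv
  suffices (T†) v = 0 by
    rw [real_inner_comm]
    exact (T.adjoint_inner_right y v).symm.trans (by rw [this, inner_zero_right])
  by_contra hv0
  have hsubset : T ⁻¹' W ⊆ {y | -(0 * ‖(T†) v‖) ≤ ⟪y, (T†) v⟫} := fun y hy => by
    rw [Set.mem_ofPred_eq, zero_mul, neg_zero, T.adjoint_inner_right, hv _ hy]
  have hhalf := measureReal_mono (μ := stdGaussian E) hsubset
  rw [stdGaussian_real_le_inner hv0, cdf_gaussianReal_zero] at hhalf
  linarith

lemma ellipsoid_subset_innerLim_floatingBody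
    (h : TendstoInDistribution X atTop T μ (stdGaussian E))
    (hX : ∀ N, ∀ᵐ ω ∂(μ N), X N ω ∈ T.range) (hq : q ∈ Set.Ioo (1 / 2 : ℝ) 1) :
    ellipsoid T (quantile (gaussianReal 0 1) q) ⊆
      innerLim fun N => floatingBody (μ N) (X N) q := by
  have hq' : q ∈ Set.Ioo (0 : ℝ) 1 := ⟨one_half_pos.trans hq.1, hq.2⟩
  have hball : T '' ball 0 (quantile (gaussianReal 0 1) q) ⊆
      innerLim fun N => floatingBody (μ N) (X N) q := by
    rintro _ ⟨b, hb, rfl⟩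
    refine mem_innerLim_of_eventually_mem <|
      eventually_mem_floatingBody h hq'.1 hX ⟨b, rfl⟩ fun v hv hv0 => ?_
    exact stdGaussian_real_inner_le_lt hq' (mem_ball_zero_iff.1 hb) hv hv0
  rw [ellipsoid, ← closure_ball 0 (quantile_gaussianReal_pos hq).ne']
  exact (image_closure_subset_closure_image T.continuous).trans
    (closure_minimal hball isClosed_innerLim)

lemma outerLim_floatingBody_subset_ellipsoid
    (h : TendstoInDistribution X atTop T μ (stdGaussian E)) (hq : q ∈ Set.Ioo (1 / 2 : ℝ) 1) :
    outerLim (fun N => floatingBody (μ N) (X N) q) ⊆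
      ellipsoid T (quantile (gaussianReal 0 1) q) := by
  intro x hx
  by_contra hxT
  obtain ⟨v, t, hxt, ht⟩ := exists_forall_lt_inner_of_notMem convex_ellipsoid isClosed_ellipsoid hxT
  obtain ⟨y, hy, hyv⟩ :=
    exists_mem_ellipsoid_inner_eq (T := T) (quantile_gaussianReal_pos hq).le v
  have hmass : q < (stdGaussian E).real {y | t < ⟪T y, v⟫} :=
    lt_stdGaussian_real_lt_inner ⟨one_half_pos.trans hq.1, hq.2⟩ (hyv ▸ ht y hy)
  exact (outerLim_floatingBody_subset h hmass hx).not_gt hxt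

theorem setTendsto_floatingBody (h : TendstoInDistribution X atTop T μ (stdGaussian E))
    (hX : ∀ N, ∀ᵐ ω ∂(μ N), X N ω ∈ T.range) (hq : q ∈ Set.Ioo (1 / 2 : ℝ) 1) :
    SetTendsto (fun N => floatingBody (μ N) (X N) q)
      (ellipsoid T (quantile (gaussianReal 0 1) q)) :=
  setTendsto_of_subset (ellipsoid_subset_innerLim_floatingBody h hX hq)
    (outerLim_floatingBody_subset_ellipsoid h hq)

end GaussianLimit

section SquareRoot

open scoped MatrixOrder

variable {S : ℕ} {M : Matrix (Fin S) (Fin S) ℝ}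

/-- The positive square root of a positive semidefinite matrix as an operator on `ℝ^S`; it maps a
standard normal vector to one with covariance matrix `M`. -/
def sqrtCLM (M : Matrix (Fin S) (Fin S) ℝ) : Vec S →L[ℝ] Vec S :=
  Matrix.toEuclideanCLM (𝕜 := ℝ) (CFC.sqrt M)

lemma multivariateGaussian_zero_eq_map :
    multivariateGaussian 0 M = (stdGaussian (Vec S)).map (sqrtCLM M) := by
  simp [multivariateGaussian, sqrtCLM]

lemma finrank_range_sqrtCLM (hM : M.PosSemidef) :
    Module.finrank ℝ (sqrtCLM M).range = M.rank := by
  have hsqrt : (CFC.sqrt M).conjTranspose = CFC.sqrt M := (CFC.sqrt_nonneg M).isSelfAdjoint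
  have hrank : (CFC.sqrt M).rank = M.rank := by
    rw [← Matrix.rank_conjTranspose_mul_self, hsqrt, CFC.sqrt_mul_sqrt_self _ hM.nonneg]
  rw [← hrank, Matrix.rank_eq_finrank_range_toLin (CFC.sqrt M)
    (EuclideanSpace.basisFun (Fin S) ℝ).toBasis (EuclideanSpace.basisFun (Fin S) ℝ).toBasis]
  congr 2

lemma tendstoInDistribution_sqrtCLM {ι : Type*} {Ω : ι → Type*} [∀ i, MeasurableSpace (Ω i)]
    {l : Filter ι} {X : (i : ι) → Ω i → Vec S} {μ : (i : ι) → Measure (Ω i)}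
    [∀ i, IsProbabilityMeasure (μ i)]
    (h : TendstoInDistribution X l id μ (multivariateGaussian 0 M)) :
    TendstoInDistribution X l (sqrtCLM M) μ (stdGaussian (Vec S)) where
  forall_aemeasurable := h.forall_aemeasurable
  tendsto := by
    simpa only [Measure.map_id, multivariateGaussian_zero_eq_map] using h.tendsto

end SquareRoot

section TangentSpace

variable {S : ℕ}

/-- The differences of vectors of the simplex: the vectors whose entries sum to zero. -/
def tangentSpace (S : ℕ) : Submodule ℝ (Vec S) :=
  (ℝ ∙ (WithLp.toLp 2 1 : Vec S))ᗮ

lemma smul_sub_mem_tangentSpace {p p' : Vec S} (hp : p ∈ simplex S) (hp' : p' ∈ simplex S) (c : ℝ) :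
    c • (p - p') ∈ tangentSpace S := by
  refine Submodule.smul_mem _ c (Submodule.mem_orthogonal_singleton_iff_inner_right.2 ?_)
  simp [PiLp.inner_apply, hp.2, hp'.2]

lemma finrank_tangentSpace (hS : 0 < S) : Module.finrank ℝ (tangentSpace S) = S - 1 := by
  have hne : (WithLp.toLp 2 1 : Vec S) ≠ 0 := fun h =>
    one_ne_zero (congrArg (fun x : Vec S => x ⟨0, hS⟩) h)
  have hsum := (ℝ ∙ (WithLp.toLp 2 1 : Vec S)).finrank_add_finrank_orthogonal
  rw [finrank_span_singleton hne, finrank_euclideanSpace_fin] at hsum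
  exact Nat.eq_sub_of_add_eq' hsum

end TangentSpace

section Posterior

variable {S A : ℕ} {s : Fin S} {a : Fin A} {post : ℕ → Measure (Model S A)}
  [∀ N, IsProbabilityMeasure (post N)] {p : Vec S} {M : Matrix (Fin S) (Fin S) ℝ} {α : ℝ}

lemma range_sqrtCLM_eq_tangentSpace (hpost : ∀ N, ∀ᵐ P ∂(post N), P s a ∈ simplex S)
    (hp : p ∈ simplex S) (hM : M.PosSemidef) (hrank : M.rank = S - 1)
    (h : TendstoInDistribution (fun (N : ℕ) (P : Model S A) => √(N : ℝ) • (P s a - p)) atTop id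
      post (multivariateGaussian 0 M)) :
    (sqrtCLM M).range = tangentSpace S := by
  refine Submodule.eq_of_le_of_finrank_eq ?_ ?_
  · exact range_le_of_ae_mem (tendstoInDistribution_sqrtCLM h) fun N =>
      (hpost N).mono fun P hP => smul_sub_mem_tangentSpace hP hp _
  · rw [finrank_range_sqrtCLM hM, hrank, finrank_tangentSpace s.pos]

theorem setTendsto_scaled_varSet (hα : α ∈ Set.Ioo (0 : ℝ) (1 / 2))
    (hpost : ∀ N, ∀ᵐ P ∂(post N), P s a ∈ simplex S) (hp : p ∈ simplex S) (hM : M.PosSemidef)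
    (hrank : M.rank = S - 1)
    (h : TendstoInDistribution (fun (N : ℕ) (P : Model S A) => √(N : ℝ) • (P s a - p)) atTop id
      post (multivariateGaussian 0 M)) (ξ : ℝ) :
    SetTendsto (scaled ξ (fun N => varSet (post N) α s a) p)
      (ξ • ellipsoid (sqrtCLM M) (quantile (gaussianReal 0 1) (1 - α))) := by
  have hq : 1 - α ∈ Set.Ioo (1 / 2 : ℝ) 1 := ⟨by linarith [hα.2], by linarith [hα.1]⟩
  have hα' : α ∈ Set.Ioo (0 : ℝ) 1 := ⟨hα.1, hα.2.trans one_half_lt_one⟩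
  have hrange (N : ℕ) : ∀ᵐ P ∂(post N), √(N : ℝ) • (P s a - p) ∈ (sqrtCLM M).range := by
    rw [range_sqrtCLM_eq_tangentSpace hpost hp hM hrank h]
    exact (hpost N).mono fun P hP => smul_sub_mem_tangentSpace hP hp _
  have hbody := setTendsto_floatingBody (tendstoInDistribution_sqrtCLM h) hrange hq
  have hone : SetTendsto (scaled 1 (fun N => varSet (post N) α s a) p)
      (ellipsoid (sqrtCLM M) (quantile (gaussianReal 0 1) (1 - α))) := by
    refine hbody.congr' ((eventually_gt_atTop 0).mono fun N hN => ?_)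
    rw [floatingBody_smul_sub (Real.sqrt_pos.2 (Nat.cast_pos.2 hN)), scaled,
      varSet_eq_floatingBody hα' (hpost N), mul_one]
  convert hone.const_smul ⟨0, zero_mem_ellipsoid (quantile_gaussianReal_pos hq).le⟩ ξ using 2 with N
  exact scaled_eq_smul ξ _ p N

theorem not_outerLim_credibleRegion_subset (hα : α ∈ Set.Ioo (0 : ℝ) (1 / 2)) (hM : M.PosSemidef)
    (hrank : M.rank = S - 1)
    (h : TendstoInDistribution (fun (N : ℕ) (P : Model S A) => √(N : ℝ) • (P s a - p)) atTop id
      post (multivariateGaussian 0 M)) {C : ℕ → Set (Vec S)}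
    (hC : ∀ N, IsCredibleRegion (post N) α s a (C N)) {ξ : ℝ} (hξ : |ξ| < radiusRatio S α) :
    ¬ outerLim (scaled 1 C p) ⊆
      ξ • ellipsoid (sqrtCLM M) (quantile (gaussianReal 0 1) (1 - α)) := by
  have hq : 1 - α ∈ Set.Ioo (1 / 2 : ℝ) 1 := ⟨by linarith [hα.2], by linarith [hα.1]⟩
  have hz := quantile_gaussianReal_pos hq
  have hmass (N : ℕ) :
      1 - α ≤ (post N).real ((fun P => √(N : ℝ) • (P s a - p)) ⁻¹' scaled 1 C p N) :=
    (hC N).2.trans (measureReal_mono fun P hP => ⟨P s a, hP, by simp only [mul_one]⟩)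
  have hradius : (|ξ| * quantile (gaussianReal 0 1) (1 - α)) ^ 2 <
      quantile (chiSquared (Module.finrank ℝ (sqrtCLM M).range)) (1 - α) := by
    rw [finrank_range_sqrtCLM hM, hrank]
    exact (Real.lt_sqrt (by positivity)).1 ((lt_div_iff₀ hz).1 hξ)
  have hnot := not_outerLim_subset_ellipsoid (tendstoInDistribution_sqrtCLM h)
    ⟨one_half_pos.trans hq.1, hq.2⟩ hmass (by positivity) hradius
  exact fun hsubset => hnot (hsubset.trans (smul_ellipsoid_subset ξ))

end Posterior

section Ray

lemma mul_lt_of_smul_notMem_smul {E : Type*} [AddCommGroup E] [Module ℝ E] {K : Set E}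
    (hK : StarConvex ℝ 0 K) {u : E} {c r t : ℝ} (ht : 0 < t) (htu : t • u ∉ c • K)
    (hru : r • u ∈ K) : c * r < t := by
  by_contra! hle
  have hpos : 0 < c * r := ht.trans_le hle
  have hmem := hK.smul_mem hru (div_nonneg ht.le hpos.le) (div_le_one_of_le₀ hle hpos.le)
  obtain ⟨hc, hr⟩ := mul_ne_zero_iff.1 hpos.ne'
  refine htu ⟨_, hmem, ?_⟩
  simp only [smul_smul]
  congr 1
  field_simp

end Ray

end CredibleRadius

end

open CredibleRadius in
theorem theorem4p3 (α : ℝ) (hα : α ∈ Set.Ioo (0 : ℝ) (1 / 2)) :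
    ∃ c c' : ℝ, 0 < c ∧
      -- the ratio grows like `√S`
      (∀ S : ℕ, 2 ≤ S → c * √(S : ℝ) ≤ radiusRatio S α ∧ radiusRatio S α ≤ c' * √(S : ℝ)) ∧
      ∀ (S A : ℕ), 2 ≤ S →
      ∀ (post : ℕ → Measure (Model S A)) [∀ N, IsProbabilityMeasure (post N)]
        (pstar : Model S A) (cov : Fin S → Fin A → Matrix (Fin S) (Fin S) ℝ),
        (∀ N, ∀ᵐ P ∂(post N), ∀ s a, P s a ∈ simplex S) →
        (∀ s a, pstar s a ∈ simplex S) →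
        AsymptoticallyNormal post pstar cov →
        ∀ (s : Fin S) (a : Fin A),
          -- `V ξ` is the limit of `√N ξ (P^VaR_{s,a} - p*_{s,a})`
          ∃ V : ℝ → Set (Vec S),
            (∀ ξ : ℝ, SetTendsto (scaled ξ (fun N => varSet (post N) α s a) (pstar s a)) (V ξ)) ∧
            ∀ C : ℕ → Set (Vec S), (∀ N, IsCredibleRegion (post N) α s a (C N)) →
              (∀ ξ : ℝ, |ξ| < radiusRatio S α →
                ¬ outerLim (scaled 1 C (pstar s a)) ⊆ V ξ ∧
                ∀ L : Set (Vec S), SetTendsto (scaled 1 C (pstar s a)) L → ¬ L ⊆ V ξ) ∧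
              -- in some direction `u` the limit of the credible regions reaches at least
              -- `c √S` times as far as the limit of the VaR ambiguity sets
              ∃ u : Vec S, u ≠ 0 ∧ ∃ t : ℝ, 0 < t ∧
                t • u ∈ outerLim (scaled 1 C (pstar s a)) ∧
                ∀ r : ℝ, 0 ≤ r → r • u ∈ V 1 → c * √(S : ℝ) * r < t := by
  obtain ⟨c, c', hc, hratio⟩ := exists_radiusRatio_bounds hα
  refine ⟨c, c', hc, fun S hS => ⟨(hratio S hS).1.le, (hratio S hS).2⟩, ?_⟩
  intro S A hS post _ pstar cov hpost hpstar hnormal s a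
  obtain ⟨hM, hrank, hlim⟩ := hnormal s a
  have hsimplex (N : ℕ) : ∀ᵐ P ∂(post N), P s a ∈ simplex S := (hpost N).mono fun P hP => hP s a
  set K := ellipsoid (sqrtCLM (cov s a)) (quantile (gaussianReal 0 1) (1 - α))
  have hzero : (0 : Vec S) ∈ K :=
    zero_mem_ellipsoid (quantile_gaussianReal_pos ⟨by linarith [hα.2], by linarith [hα.1]⟩).le
  refine ⟨fun ξ => ξ • K,
    setTendsto_scaled_varSet hα hsimplex (hpstar s a) hM hrank hlim, fun C hC => ?_⟩
  have hnot {ξ : ℝ} (hξ : |ξ| < radiusRatio S α) : ¬ outerLim (scaled 1 C (pstar s a)) ⊆ ξ • K :=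
    not_outerLim_credibleRegion_subset hα hM hrank hlim hC hξ
  refine ⟨fun ξ hξ => ⟨hnot hξ, fun L hL => hL.2 ▸ hnot hξ⟩, ?_⟩
  have hsqrt : |c * √(S : ℝ)| < radiusRatio S α := by
    rw [abs_of_nonneg (by positivity)]
    exact (hratio S hS).1
  obtain ⟨u, hu, huK⟩ := Set.not_subset.1 (hnot hsqrt)
  have hu0 : u ≠ 0 := by
    rintro rfl
    exact huK (Set.zero_mem_smul_set hzero)
  refine ⟨u, hu0, 1, one_pos, by rwa [one_smul], fun r _ hr => ?_⟩
  exact mul_lt_of_smul_notMem_smul (convex_ellipsoid.starConvex hzero) one_pos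
    (by rwa [one_smul]) (by simpa only [one_smul] using hr)
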